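/- Let $E$ be a field with a valuation $v$ (with arbitrary value group, written additively) such that $v(2)=0$. Let $f(t)=\sum_{j=0}^n a_jt^j\in E[t]$ be a polynomial of degree $n$, and let $F/E$ be a field extension such that $F=E(X)[\sqrt{f(X)}]$ for some $X\in F$ transcendental over $E$; that is, $F=E(X,Y)$ for some $Y\in F$ with $Y^2=f(X)$ (for example, $F$ is the function field of the hyperelliptic curve $Y^2=f(X)$ over $E$ if $f$ is square-free). A valuation $w$ on $F$ extending $v$ is called residually transcendental if the residue field extension $Fw/Ev$ is transcendental, and overt with respect to $(f,X)$ if $$w(f(X))=\min\{w(a_jX^j)\mid 0\le j\le n\}.$$ The extension $Fw/Ev$ is called ruled if $Fw=\ell(x)$ for some finite extension $\ell/Ev$ contained in $Fw$ and some $x\in Fw$ transcendental over $Ev$, and non-ruled otherwise. Valuations on $F$ with the same valuation ring are identified. Then there are at most $n^2$ residually transcendental extensions $w$ of $v$ to $F$ that are overt with respect to $(f,X)$ and for which $Fw/Ev$ is non-ruled. -/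

import Mathlib

open Polynomial

/-- A field extension `L / K` is ruled if `L = K'(x)` for some intermediate field `K'` that is
finite over `K` and some element `x` of `L` that is transcendental over `K`. -/
def IsRuledExtension (K L : Type*) [Field K] [Field L] [Algebra K L] : Prop :=
  ∃ K' : IntermediateField K L, FiniteDimensional K K' ∧
    ∃ x : L, Transcendental K x ∧ IntermediateField.adjoin K' {x} = ⊤

/-- The residue field of a valuation on a field. -/
abbrev ValuationResidueField {K Γ : Type*} [Field K] [LinearOrderedCommGroupWithZero Γ]
    (v : Valuation K Γ) : Type _ :=
  IsLocalRing.ResidueField v.valuationSubring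

section Extensions

variable {E F Γ Γ' : Type*} [Field E] [Field F] [Algebra E F]
  [LinearOrderedCommGroupWithZero Γ] [LinearOrderedCommGroupWithZero Γ']

/-- `w` is a residually transcendental extension of `v`: it extends `v` (up to equivalence), and
the residue field extension is transcendental, that is, not algebraic. -/
def IsResiduallyTranscendentalExtension (v : Valuation E Γ) (w : Valuation F Γ') : Prop :=
  ∃ _ : v.HasExtension w,
    Algebra.Transcendental (ValuationResidueField v) (ValuationResidueField w)

/-- `w` is an extension of `v` whose residue field extension is not ruled. -/
def IsResiduallyNonRuledExtension (v : Valuation E Γ) (w : Valuation F Γ') : Prop :=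
  ∃ _ : v.HasExtension w,
    ¬ IsRuledExtension (ValuationResidueField v) (ValuationResidueField w)

/-- `w` is overt with respect to `(f, X)`, where `f = ∑ aⱼ tʲ`. Additively, this says
`w (f(X)) = min {w (aⱼ Xʲ) | 0 ≤ j ≤ deg f}`; Mathlib's valuations are multiplicative, so that
the minimum becomes a maximum. -/
def IsOvert (w : Valuation F Γ') (f : E[X]) (x : F) : Prop :=
  w (aeval x f) = (Finset.range (f.natDegree + 1)).sup' Finset.nonempty_range_add_one
    fun j => w (algebraMap E F (f.coeff j) * x ^ j)

/-- The set of residually transcendental extensions of `v` to `F` that are overt with respect to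
`(f, x)` and whose residue field extension is not ruled. Valuations on `F` are identified when they
have the same valuation ring, and are represented by that ring. -/
def overtNonRuledExtensions (v : Valuation E Γ) (f : E[X]) (x : F) : Set (ValuationSubring F) :=
  {A | IsResiduallyTranscendentalExtension v A.valuation ∧ IsOvert A.valuation f x ∧
    IsResiduallyNonRuledExtension v A.valuation}

end Extensions

/-! Call an element residually algebraic if, up to a scalar from `E`, some positive power of it is a
unit with algebraic residue. Suppose `Q` is not residually algebraic. A sum of terms `Q ^ i * a_i`,
with each `a_i` zero or residually algebraic, then has no cancellation, and relative to a dominant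
term its residue is rational in a single transcendental residue over the algebraic closure of the
base residue field. That closure is a finite extension, because independent algebraic residues lift
to elements independent over `E(u)`, and `[F : E(u)]` is finite. Hence the residue extension is
ruled as soon as every unit is, up to smaller terms, a quotient of such sums
(`isRuledExtension_of_isGradedSum`).

Three situations provide such a `Q`. If `E(x)` and `E(x) y` are not orthogonal, the residues all
come from `E(x)`, and `Q = q(x)` works for a polynomial `q` of least degree with `q(x)` not
residually algebraic. If `y` is residually algebraic and orthogonality holds, the same choice works
with coefficients `c(x) + d(x) y`. If `y ^ 2 = x * a` with `a` residually algebraic and `x` not, `Q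
= y` works.

Let `w` be overt and non-ruled. If `x` were residually algebraic, so would be `f(x)`, hence `y`;
thus `x` is not. If a single term `a_j x ^ j` dominated `f(x)`, then `f(x) / x ^ j` would be
residually algebraic, and dividing `y` by a power of `x` would lead, by the parity of `j`, to one of
the cases above. So two terms `i < j` tie, which gives `w(x) ^ (j - i) = w(a_i / a_j)`. Since `x` is
not residually algebraic, polynomials in `x` have no cancellation, so this determines `w` on `E(x)`;
orthogonality then determines it on `F`. Therefore `w` is determined by the pair `(i, j)`. -/

/-! ### Residues of elements of a valued field. -/

section ResidueMap

variable {F Γ' : Type*} [Field F] [LinearOrderedCommGroupWithZero Γ']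

open Classical in
/-- The residue of an element of the valuation ring, extended by zero to the whole field. -/
noncomputable def valuationResidue (w : Valuation F Γ') (z : F) : ValuationResidueField w :=
  if h : w z ≤ 1 then IsLocalRing.residue w.valuationSubring ⟨z, h⟩ else 0

variable {w : Valuation F Γ'}

theorem valuationResidue_of_le {z : F} (h : w z ≤ 1) :
    valuationResidue w z = IsLocalRing.residue w.valuationSubring ⟨z, h⟩ := dif_pos h

theorem valuationResidue_add {a b : F} (ha : w a ≤ 1) (hb : w b ≤ 1) :
    valuationResidue w (a + b) = valuationResidue w a + valuationResidue w b := by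
  rw [valuationResidue_of_le ha, valuationResidue_of_le hb,
    valuationResidue_of_le (w.map_add_le ha hb), ← map_add]
  rfl

theorem valuationResidue_mul {a b : F} (ha : w a ≤ 1) (hb : w b ≤ 1) :
    valuationResidue w (a * b) = valuationResidue w a * valuationResidue w b := by
  have h : w (a * b) ≤ 1 := by rw [map_mul]; exact mul_le_one' ha hb
  rw [valuationResidue_of_le ha, valuationResidue_of_le hb, valuationResidue_of_le h, ← map_mul]
  rfl

@[simp]
theorem valuationResidue_one : valuationResidue w 1 = 1 := by
  rw [valuationResidue_of_le (by simp)]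
  exact map_one _

@[simp]
theorem valuationResidue_zero : valuationResidue w 0 = 0 := by
  rw [valuationResidue_of_le (by simp)]
  exact map_zero _

theorem valuationResidue_eq_zero_iff {z : F} (h : w z ≤ 1) :
    valuationResidue w z = 0 ↔ w z < 1 := by
  rw [valuationResidue_of_le h, IsLocalRing.residue_eq_zero_iff, IsLocalRing.mem_maximalIdeal,
    mem_nonunits_iff]
  exact ((Valuation.integer.integers w).isUnit_iff_valuation_eq_one.not).trans
    (lt_iff_le_and_ne.trans (and_iff_right h)).symm

theorem valuationResidue_pow {a : F} (ha : w a ≤ 1) (n : ℕ) :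
    valuationResidue w (a ^ n) = valuationResidue w a ^ n := by
  induction n with
  | zero => simp
  | succ n ih =>
    rw [pow_succ, valuationResidue_mul (by rw [map_pow]; exact pow_le_one' ha n) ha, ih, pow_succ]

theorem valuationResidue_inv {a : F} (ha : w a = 1) :
    valuationResidue w a⁻¹ = (valuationResidue w a)⁻¹ := by
  have ha' : w a⁻¹ = 1 := by simp [ha]
  refine eq_inv_of_mul_eq_one_left ?_
  rw [← valuationResidue_mul ha'.le ha.le, inv_mul_cancel₀, valuationResidue_one]
  rintro rfl
  simp at ha

theorem valuationResidue_zpow {a : F} (ha : w a = 1) (n : ℤ) :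
    valuationResidue w (a ^ n) = valuationResidue w a ^ n := by
  cases n with
  | ofNat n => simpa using valuationResidue_pow ha.le n
  | negSucc n =>
    rw [zpow_negSucc, zpow_negSucc, valuationResidue_inv (by simp [ha]),
      valuationResidue_pow ha.le]

theorem valuationResidue_sum {ι : Type*} (s : Finset ι) {t : ι → F} (h : ∀ i ∈ s, w (t i) ≤ 1) :
    valuationResidue w (∑ i ∈ s, t i) = ∑ i ∈ s, valuationResidue w (t i) := by
  classical
  induction s using Finset.induction_on with
  | empty => simp
  | insert a s ha ih =>
    rw [Finset.sum_insert ha, Finset.sum_insert ha, valuationResidue_add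
      (h _ (Finset.mem_insert_self _ _))
      (w.map_sum_le fun i hi => h _ (Finset.mem_insert_of_mem hi)),
      ih fun i hi => h _ (Finset.mem_insert_of_mem hi)]

theorem valuationResidue_eq_of_sub_lt {a b : F} (ha : w a ≤ 1) (h : w (b - a) < 1) :
    valuationResidue w b = valuationResidue w a := by
  have := valuationResidue_add ha h.le
  rwa [(valuationResidue_eq_zero_iff h.le).2 h, add_zero, add_sub_cancel] at this

theorem exists_valuationResidue_eq (r : ValuationResidueField w) :
    ∃ z, w z ≤ 1 ∧ valuationResidue w z = r := by
  obtain ⟨⟨z, hz⟩, rfl⟩ := IsLocalRing.residue_surjective r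
  exact ⟨z, hz, valuationResidue_of_le hz⟩

end ResidueMap

/-! ### Residually algebraic elements. -/

section ResiduallyAlgebraic

variable {E F Γ Γ' : Type*} [Field E] [Field F] [Algebra E F]
  [LinearOrderedCommGroupWithZero Γ] [LinearOrderedCommGroupWithZero Γ']
  {v : Valuation E Γ} {w : Valuation F Γ'} [v.HasExtension w]

theorem valuationResidue_algebraMap {c : E} (hc : v c ≤ 1) :
    valuationResidue w (algebraMap E F c) =
      algebraMap (ValuationResidueField v) (ValuationResidueField w) (valuationResidue v c) := by
  rw [valuationResidue_of_le hc,
    valuationResidue_of_le ((Valuation.HasExtension.val_map_le_one_iff v w c).2 hc)]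
  rfl

variable (v w)

/-- A unit of the valuation ring of `w` whose residue is algebraic over the residue field of `v`. -/
def IsResiduallyAlgebraicUnit (z : F) : Prop :=
  w z = 1 ∧ IsAlgebraic (ValuationResidueField v) (valuationResidue w z)

/-- An element some positive power of which is, up to a scalar, a unit with algebraic residue. -/
def IsResiduallyAlgebraic (z : F) : Prop :=
  ∃ N : ℕ, 0 < N ∧ ∃ c : E, c ≠ 0 ∧ IsResiduallyAlgebraicUnit v w (z ^ N / algebraMap E F c)

variable {v w}

theorem IsResiduallyAlgebraicUnit.mul {a b : F} (ha : IsResiduallyAlgebraicUnit v w a)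
    (hb : IsResiduallyAlgebraicUnit v w b) : IsResiduallyAlgebraicUnit v w (a * b) :=
  ⟨by rw [map_mul, ha.1, hb.1, one_mul],
    by rw [valuationResidue_mul ha.1.le hb.1.le]; exact ha.2.mul hb.2⟩

theorem IsResiduallyAlgebraicUnit.inv {a : F} (ha : IsResiduallyAlgebraicUnit v w a) :
    IsResiduallyAlgebraicUnit v w a⁻¹ :=
  ⟨by rw [map_inv₀, ha.1, inv_one], by rw [valuationResidue_inv ha.1]; exact ha.2.inv⟩

theorem IsResiduallyAlgebraicUnit.pow {a : F} (ha : IsResiduallyAlgebraicUnit v w a) (n : ℕ) :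
    IsResiduallyAlgebraicUnit v w (a ^ n) :=
  ⟨by rw [map_pow, ha.1, one_pow], by rw [valuationResidue_pow ha.1.le]; exact ha.2.pow n⟩

theorem IsResiduallyAlgebraicUnit.isResiduallyAlgebraic {a : F}
    (ha : IsResiduallyAlgebraicUnit v w a) : IsResiduallyAlgebraic v w a :=
  ⟨1, one_pos, 1, one_ne_zero, by simpa using ha⟩

namespace IsResiduallyAlgebraic

theorem ne_zero {a : F} (ha : IsResiduallyAlgebraic v w a) : a ≠ 0 := by
  rintro rfl
  obtain ⟨N, hN, c, hc, h⟩ := ha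
  have := h.1
  simp [hN.ne'] at this

theorem mul {a b : F} (ha : IsResiduallyAlgebraic v w a) (hb : IsResiduallyAlgebraic v w b) :
    IsResiduallyAlgebraic v w (a * b) := by
  obtain ⟨N, hN, c, hc, h⟩ := ha
  obtain ⟨M, hM, d, hd, h'⟩ := hb
  refine ⟨N * M, Nat.mul_pos hN hM, c ^ M * d ^ N, by positivity, ?_⟩
  convert (h.pow M).mul (h'.pow N) using 1
  simp only [map_mul, map_pow, div_pow, mul_pow, ← pow_mul]
  rw [mul_comm M N]
  ring

theorem inv {a : F} (ha : IsResiduallyAlgebraic v w a) : IsResiduallyAlgebraic v w a⁻¹ := by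
  obtain ⟨N, hN, c, hc, h⟩ := ha
  refine ⟨N, hN, c⁻¹, inv_ne_zero hc, ?_⟩
  convert h.inv using 1
  simp [div_eq_mul_inv, mul_comm]

theorem div {a b : F} (ha : IsResiduallyAlgebraic v w a) (hb : IsResiduallyAlgebraic v w b) :
    IsResiduallyAlgebraic v w (a / b) := by
  rw [div_eq_mul_inv]; exact ha.mul hb.inv

theorem of_algebraMap {c : E} (hc : c ≠ 0) : IsResiduallyAlgebraic v w (algebraMap E F c) :=
  ⟨1, one_pos, c, hc, by simp [hc, IsResiduallyAlgebraicUnit, isAlgebraic_one]⟩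

theorem one : IsResiduallyAlgebraic v w 1 := by
  simpa using IsResiduallyAlgebraic.of_algebraMap (v := v) (w := w) one_ne_zero

theorem pow {a : F} (ha : IsResiduallyAlgebraic v w a) (n : ℕ) :
    IsResiduallyAlgebraic v w (a ^ n) := by
  induction n with
  | zero => simpa using one
  | succ n ih => rw [pow_succ]; exact ih.mul ha

theorem zpow {a : F} (ha : IsResiduallyAlgebraic v w a) (n : ℤ) :
    IsResiduallyAlgebraic v w (a ^ n) := by
  cases n with
  | ofNat n => simpa using ha.pow n
  | negSucc n => rw [zpow_negSucc]; exact (ha.pow _).inv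

theorem of_pow {a : F} {k : ℕ} (hk : 0 < k) (ha : IsResiduallyAlgebraic v w (a ^ k)) :
    IsResiduallyAlgebraic v w a := by
  obtain ⟨N, hN, c, hc, h⟩ := ha
  exact ⟨k * N, Nat.mul_pos hk hN, c, hc, by rwa [pow_mul]⟩

theorem isAlgebraic {a : F} (ha : IsResiduallyAlgebraic v w a) (h1 : w a = 1) :
    IsAlgebraic (ValuationResidueField v) (valuationResidue w a) := by
  obtain ⟨N, hN, c, hc, h⟩ := ha
  -- As `a` and `a ^ N / c` are both units, `c` is one too, and its residue lies in the base residue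
  -- field.
  have hc1 : w (algebraMap E F c) = 1 := by
    have := h.1
    rw [map_div₀, map_pow, h1, one_pow, one_div, inv_eq_one] at this
    exact this
  have hcv : v c = 1 := (Valuation.HasExtension.val_map_eq_one_iff v w c).1 hc1
  refine IsAlgebraic.of_pow hN ?_
  rw [← valuationResidue_pow h1.le, ← div_mul_cancel₀ (a ^ N) ((_root_.map_ne_zero (algebraMap E F)).2 hc),
    valuationResidue_mul h.1.le hc1.le, valuationResidue_algebraMap hcv.le]
  exact h.2.mul (isAlgebraic_algebraMap _)

end IsResiduallyAlgebraic

theorem isAlgebraic_valuationResidue {a : F} (ha : a = 0 ∨ IsResiduallyAlgebraic v w a)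
    (h1 : w a ≤ 1) : IsAlgebraic (ValuationResidueField v) (valuationResidue w a) := by
  rcases h1.lt_or_eq with h | h
  · rw [(valuationResidue_eq_zero_iff h1).2 h]; exact isAlgebraic_zero
  · rcases ha with rfl | ha
    · simp at h
    · exact ha.isAlgebraic h

/-- A sum of residually algebraic elements without cancellation is residually algebraic. -/
theorem IsResiduallyAlgebraic.sum {ι : Type*} {s : Finset ι} {t : ι → F}
    (ht : ∀ i ∈ s, t i = 0 ∨ IsResiduallyAlgebraic v w (t i)) {j : ι} (hj : j ∈ s)
    (hle : ∀ i ∈ s, w (t i) ≤ w (t j)) (heq : w (∑ i ∈ s, t i) = w (t j)) (hj0 : t j ≠ 0) :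
    IsResiduallyAlgebraic v w (∑ i ∈ s, t i) := by
  have htj := (ht j hj).resolve_left hj0
  have hw : w (t j) ≠ 0 := (Valuation.ne_zero_iff _).2 hj0
  have hle' : ∀ i ∈ s, w (t i / t j) ≤ 1 := fun i hi => by
    rw [map_div₀]; exact div_le_one_of_le₀ (hle i hi) zero_le
  -- Relative to the dominant term, the sum is a unit whose residue is a sum of algebraic residues.
  have hu : IsResiduallyAlgebraicUnit v w ((∑ i ∈ s, t i) / t j) := by
    refine ⟨by rw [map_div₀, heq, div_self hw], ?_⟩
    rw [Finset.sum_div, valuationResidue_sum s hle']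
    refine (Subalgebra.algebraicClosure (ValuationResidueField v)
      (ValuationResidueField w)).sum_mem
      fun i hi => isAlgebraic_valuationResidue ?_ (hle' i hi)
    rcases ht i hi with h | h
    · simp [h]
    · exact .inr (h.div htj)
  rw [← div_mul_cancel₀ (∑ i ∈ s, t i) hj0]
  exact hu.isResiduallyAlgebraic.mul htj

theorem IsResiduallyAlgebraic.add {a b : F} (ha : a = 0 ∨ IsResiduallyAlgebraic v w a)
    (hb : b = 0 ∨ IsResiduallyAlgebraic v w b) (h : w (a + b) = max (w a) (w b)) :
    a + b = 0 ∨ IsResiduallyAlgebraic v w (a + b) := by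
  by_cases hab : a + b = 0
  · exact .inl hab
  right
  wlog hle : w b ≤ w a generalizing a b
  · rw [add_comm]
    exact this hb ha (by rw [add_comm, h, max_comm]) (by rwa [add_comm]) (le_of_not_ge hle)
  rw [max_eq_left hle] at h
  have ha0 : a ≠ 0 := by
    rintro rfl
    rw [map_zero, Valuation.zero_iff] at h
    exact hab h
  have := IsResiduallyAlgebraic.sum (v := v) (w := w) (s := Finset.univ) (t := ![a, b])
    (by simp [Fin.forall_fin_two, ha, hb]) (j := 0) (by simp) (by simp [Fin.forall_fin_two, hle])
    (by simpa using h) ha0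
  simpa using this

end ResiduallyAlgebraic

/-! ### Finiteness of the algebraic part of the residue extension. -/

section Finiteness

variable {E F Γ Γ' : Type*} [Field E] [Field F] [Algebra E F]
  [LinearOrderedCommGroupWithZero Γ] [LinearOrderedCommGroupWithZero Γ']
  {v : Valuation E Γ} {w : Valuation F Γ'} [v.HasExtension w]

open IntermediateField

/-- A field generated by `x` and `y`, with `y` algebraic over `E(x)`, is finite over `E(u)` for every
transcendental `u`. -/
theorem finiteDimensional_adjoin_simple_of_transcendental {x y u : F}
    (hy : IsAlgebraic E⟮x⟯ y) (hF : adjoin E {x, y} = ⊤) (hu : Transcendental E u) :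
    FiniteDimensional E⟮u⟯ F := by
  have hx : ∀ z : F, IsAlgebraic E⟮x⟯ z := by
    have h : adjoin E {x, y} ≤ (algebraicClosure E⟮x⟯ F).restrictScalars E := by
      rw [adjoin_le_iff]
      rintro z (rfl | rfl)
      · exact mem_algebraicClosure_iff.2
          (isAlgebraic_algebraMap (⟨z, mem_adjoin_simple_self E z⟩ : E⟮z⟯))
      · exact mem_algebraicClosure_iff.2 hy
    intro z
    exact mem_algebraicClosure_iff.1 (h (hF ▸ mem_top : z ∈ adjoin E {x, y}))
  have hx' : Algebra.IsAlgebraic E⟮x⟯ F := ⟨hx⟩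
  have : Algebra.IsAlgebraic (Algebra.adjoin E {x}) F :=
    open scoped algebraAdjoinAdjoin in Algebra.IsAlgebraic.trans _ E⟮x⟯ _
  have htr : Algebra.trdeg E F ≤ 1 := by
    simpa using Algebra.IsAlgebraic.trdeg_le_cardinalMk E {x}
  -- The transcendence degree is at most one, so the single element `u` is already a transcendence
  -- basis.
  have hb : IsTranscendenceBasis E (fun _ : PUnit => u) :=
    AlgebraicIndependent.isTranscendenceBasis_of_trdeg_le
      (algebraicIndependent_unique_type_iff.2 hu) (htr.trans_lt Cardinal.one_lt_aleph0) (by simpa)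
  have halg := hb.isAlgebraic_field
  rw [Set.range_const] at halg
  have hfin : FiniteDimensional E⟮u⟯ (adjoin E⟮u⟯ {x, y}) :=
    finiteDimensional_adjoin fun z _ => (halg.isAlgebraic z).isIntegral
  have htop : adjoin E⟮u⟯ {x, y} = ⊤ := by
    rw [eq_top_iff]
    intro z _
    have : adjoin E {x, y} ≤ (adjoin E⟮u⟯ {x, y}).restrictScalars E := by
      rw [adjoin_le_iff]
      exact subset_adjoin _ _
    exact this (hF ▸ mem_top)
  rw [htop] at hfin
  exact Module.Finite.equiv (topEquiv (F := E⟮u⟯) (E := F)).toLinearEquiv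

/-- If `u` has transcendental residue, then elements whose residues are linearly independent and
algebraic satisfy no nontrivial linear relation over `E[u]`. -/
theorem eq_zero_of_sum_aeval_mul_eq_zero {u : F} (hu1 : w u ≤ 1)
    (hu : Transcendental (ValuationResidueField v) (valuationResidue w u)) {ι : Type*} [Fintype ι]
    {b : ι → F} (hb : ∀ i, w (b i) ≤ 1)
    (c : ι → algebraicClosure (ValuationResidueField v) (ValuationResidueField w))
    (hc : ∀ i, valuationResidue w (b i) = c i) (hli : LinearIndependent (ValuationResidueField v) c)
    {p : ι → E[X]} (hg : ∑ i, aeval u (p i) * b i = 0) (i : ι) : p i = 0 := by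
  revert i
  by_contra! hne
  obtain ⟨i₁, hp0⟩ := hne
  set N := Finset.univ.sup (fun i => (p i).natDegree) + 1 with hN
  have hdeg : ∀ i, (p i).natDegree < N := fun i =>
    Nat.lt_succ_of_le (Finset.le_sup (f := fun i => (p i).natDegree) (Finset.mem_univ i))
  -- Dividing by a coefficient of largest value makes all coefficients integral and one of them `1`,
  -- so the relation stays nontrivial after reduction.
  obtain ⟨⟨i₀, j₀⟩, hij, hmax⟩ := Finset.exists_max_image
    (Finset.univ ×ˢ Finset.range N : Finset (ι × ℕ)) (fun q => v ((p q.1).coeff q.2))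
    ⟨(i₁, (p i₁).natDegree), by simp [hdeg]⟩
  set d := (p i₀).coeff j₀ with hd
  have hj₀ : j₀ < N := by simpa using hij
  have hd0 : d ≠ 0 := by
    intro h0
    have h1 := hmax (i₁, (p i₁).natDegree) (by simp [hdeg])
    simp only [h0, map_zero, le_zero_iff, Valuation.zero_iff] at h1
    exact hp0 (leadingCoeff_eq_zero.1 h1)
  have hq : ∀ i, ∀ j ∈ Finset.range N, v ((p i).coeff j / d) ≤ 1 := fun i j hj => by
    rw [map_div₀]
    exact div_le_one_of_le₀ (hmax (i, j) (by simpa using hj)) zero_le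
  have hsum : ∑ i, (∑ j ∈ Finset.range N, algebraMap E F ((p i).coeff j / d) * u ^ j) * b i = 0 := by
    have : ∀ i, ∑ j ∈ Finset.range N, algebraMap E F ((p i).coeff j / d) * u ^ j =
        aeval u (p i) / algebraMap E F d := fun i => by
      rw [aeval_eq_sum_range' (hdeg i), Finset.sum_div]
      refine Finset.sum_congr rfl fun j _ => ?_
      rw [map_div₀, Algebra.smul_def]
      ring
    simp only [this, div_mul_eq_mul_div, ← Finset.sum_div]
    rw [hg, zero_div]
  have hq' : ∀ i, ∀ j ∈ Finset.range N, w (algebraMap E F ((p i).coeff j / d)) ≤ 1 :=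
    fun i j hj => (Valuation.HasExtension.val_map_le_one_iff v w _).2 (hq i j hj)
  have hu1' : ∀ j : ℕ, w (u ^ j) ≤ 1 := fun j => by rw [map_pow]; exact pow_le_one' hu1 j
  have hterm : ∀ i, ∀ j ∈ Finset.range N,
      w (algebraMap E F ((p i).coeff j / d) * u ^ j) ≤ 1 := fun i j hj => by
    rw [map_mul]; exact mul_le_one' (hq' i j hj) (hu1' j)
  have hin : ∀ i, w (∑ j ∈ Finset.range N, algebraMap E F ((p i).coeff j / d) * u ^ j) ≤ 1 :=
    fun i => w.map_sum_le (hterm i)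
  set r : ι → ℕ → ValuationResidueField v := fun i j => valuationResidue v ((p i).coeff j / d)
  have hres := congrArg (valuationResidue w) hsum
  rw [valuationResidue_sum _ (fun i _ => by rw [map_mul]; exact mul_le_one' (hin i) (hb i)),
    valuationResidue_zero] at hres
  set P : (algebraicClosure (ValuationResidueField v) (ValuationResidueField w))[X] :=
    ∑ j ∈ Finset.range N, C (∑ i, r i j • c i) * X ^ j with hP
  have hP0 : aeval (valuationResidue w u) P = 0 := by
    rw [← hres, hP, map_sum]
    simp only [map_mul, map_pow, aeval_X, aeval_C]
    have : ∀ i, valuationResidue w ((∑ j ∈ Finset.range N,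
        algebraMap E F ((p i).coeff j / d) * u ^ j) * b i) =
        ∑ j ∈ Finset.range N, (algebraMap _ _ (r i j) * (c i : ValuationResidueField w)) *
          valuationResidue w u ^ j := fun i => by
      rw [valuationResidue_mul (hin i) (hb i), hc, valuationResidue_sum _ (hterm i), Finset.sum_mul]
      refine Finset.sum_congr rfl fun j hj => ?_
      rw [valuationResidue_mul (hq' i j hj) (hu1' j), valuationResidue_pow hu1,
        valuationResidue_algebraMap (hq i j hj)]
      ring
    rw [Finset.sum_congr rfl fun i _ => this i, Finset.sum_comm]
    refine Finset.sum_congr rfl fun j _ => ?_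
    rw [← Finset.sum_mul, map_sum]
    congr 1
    refine Finset.sum_congr rfl fun i _ => ?_
    rw [Algebra.smul_def, map_mul]
    rfl
  -- The residue of `u` remains transcendental over the algebraic closure of the base residue field.
  have hP0' : P = 0 := by
    by_contra h
    exact hu.algebraicClosure ⟨P, h, hP0⟩
  have hcoeff : ∑ i, r i j₀ • c i = 0 := by
    have := congrArg (fun p => coeff p j₀) hP0'
    simp only [hP, finsetSum_coeff, coeff_C_mul, coeff_X_pow, coeff_zero] at this
    simpa [hj₀] using this
  have h1 : r i₀ j₀ = 0 := Fintype.linearIndependent_iff.1 hli _ hcoeff i₀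
  simp [r, ← hd, div_self hd0] at h1

/-- If `u` has transcendental residue, then elements whose residues are linearly independent and
algebraic are linearly independent over `E(u)`. -/
theorem linearIndependent_adjoin_simple_of_residue {u : F} (hu1 : w u ≤ 1)
    (hu : Transcendental (ValuationResidueField v) (valuationResidue w u)) {ι : Type*} [Fintype ι]
    {b : ι → F} (hb : ∀ i, w (b i) ≤ 1)
    (c : ι → algebraicClosure (ValuationResidueField v) (ValuationResidueField w))
    (hc : ∀ i, valuationResidue w (b i) = c i) (hli : LinearIndependent (ValuationResidueField v) c) :
    LinearIndependent E⟮u⟯ b := by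
  -- Clearing denominators reduces independence over `E(u)` to independence over `E[u]`.
  open scoped algebraAdjoinAdjoin in
  rw [← LinearIndependent.iff_fractionRing (R := Algebra.adjoin E {u})]
  rw [Fintype.linearIndependent_iff]
  intro g hg i
  have hp : ∀ i, ∃ p : E[X], aeval u p = (g i : F) := fun i =>
    (Algebra.adjoin_singleton_eq_range_aeval E u).le (g i).2
  choose p hp using hp
  have h0 := eq_zero_of_sum_aeval_mul_eq_zero hu1 hu hb c hc hli (p := p)
    (by simp only [hp]; exact hg) i
  exact Subtype.ext (by rw [← hp, h0, map_zero]; rfl)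

theorem finiteDimensional_of_card_le {K V : Type*} [Field K] [AddCommGroup V] [Module K V] (n : ℕ)
    (h : ∀ s : Finset V, LinearIndependent K (fun i : s => (i : V)) → s.card ≤ n) :
    FiniteDimensional K V := by
  rw [FiniteDimensional, ← Module.rank_lt_aleph0_iff]
  exact (rank_le h).trans_lt Cardinal.natCast_lt_aleph0

/-- Independent algebraic residues lift to elements independent over `E(u)`, so their number is at
most `[F : E(u)]`. -/
theorem finiteDimensional_algebraicClosure_residueField {u : F} (hu1 : w u ≤ 1)
    (hu : Transcendental (ValuationResidueField v) (valuationResidue w u))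
    [FiniteDimensional E⟮u⟯ F] :
    FiniteDimensional (ValuationResidueField v)
      (algebraicClosure (ValuationResidueField v) (ValuationResidueField w)) := by
  refine finiteDimensional_of_card_le (Module.finrank E⟮u⟯ F) fun s hs => ?_
  choose b hb1 hb using fun i : s => exists_valuationResidue_eq (w := w) (i : ValuationResidueField w)
  simpa using (linearIndependent_adjoin_simple_of_residue hu1 hu hb1 _ hb hs).fintype_card_le_finrank

/-- An element with transcendental residue is transcendental. -/
theorem transcendental_of_valuationResidue {u : F} (hu1 : w u ≤ 1)
    (hu : Transcendental (ValuationResidueField v) (valuationResidue w u)) :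
    Transcendental E u := by
  rw [transcendental_iff]
  intro p hp
  exact eq_zero_of_sum_aeval_mul_eq_zero (v := v) hu1 hu (ι := Unit) (b := fun _ => 1) (by simp)
    (fun _ => 1) (by simp) (LinearIndependent.of_subsingleton () one_ne_zero)
    (p := fun _ => p) (by simp [hp]) ()

end Finiteness

/-! ### Graded sums and the ruledness criterion. -/

section Graded

variable {E F Γ Γ' : Type*} [Field E] [Field F] [Algebra E F]
  [LinearOrderedCommGroupWithZero Γ] [LinearOrderedCommGroupWithZero Γ']

open IntermediateField

theorem isRuledExtension_of_forall_mem_adjoin {K L : Type*} [Field K] [Field L] [Algebra K L]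
    [FiniteDimensional K (algebraicClosure K L)] {x : L} (hx : Transcendental K x)
    (h : ∀ z : L, z ∈ adjoin (algebraicClosure K L) {x}) : IsRuledExtension K L :=
  ⟨algebraicClosure K L, inferInstance, x, hx, eq_top_iff.2 fun z _ => h z⟩

theorem mem_adjoin_algebraicClosure {K L : Type*} [Field K] [Field L] [Algebra K L] {x z : L}
    (h : IsAlgebraic K z) : z ∈ adjoin (algebraicClosure K L) {x} :=
  IntermediateField.algebraMap_mem (adjoin (algebraicClosure K L) {x})
    (⟨z, mem_algebraicClosure_iff.2 h⟩ : algebraicClosure K L)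

variable (v : Valuation E Γ) (w : Valuation F Γ') [v.HasExtension w]

/-- The elements `Q ^ k * a` with `a` residually algebraic, together with `0`. -/
def IsGradedPiece (Q : F) (k : ℤ) (z : F) : Prop :=
  z = 0 ∨ ∃ a, IsResiduallyAlgebraic v w a ∧ z = Q ^ k * a

/-- A finite sum of elements of `IsGradedPiece`, at most one in each degree. -/
def IsGradedSum (Q z : F) : Prop :=
  ∃ (N : ℕ) (t : ℕ → F), (∀ i : ℕ, IsGradedPiece v w Q i (t i)) ∧ z = ∑ i ∈ Finset.range N, t i

variable {v w}

/-- There is a unit `u` with transcendental residue such that the residue of every unit of the form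
`Q ^ k * a`, with `a` residually algebraic, is an algebraic multiple of a power of that of `u`. -/
theorem exists_transcendental_valuationResidue
    (hw : ∃ z, w z = 1 ∧ Transcendental (ValuationResidueField v) (valuationResidue w z))
    {Q : F} (hQ0 : Q ≠ 0) (hQ : ¬ IsResiduallyAlgebraic v w Q) :
    ∃ u, w u = 1 ∧ Transcendental (ValuationResidueField v) (valuationResidue w u) ∧
      ∀ (k : ℤ) (a : F), IsResiduallyAlgebraic v w a → w (Q ^ k * a) = 1 →
        ∃ (m : ℤ) (c : ValuationResidueField w), IsAlgebraic (ValuationResidueField v) c ∧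
          valuationResidue w (Q ^ k * a) = c * valuationResidue w u ^ m ∧
          (k = 0 → m = 0) ∧ (0 < k → 0 < m) := by
  -- If no positive power of `Q` has the value of a residually algebraic element, units arise only
  -- for `k = 0` and any transcendental unit serves as `u`. Otherwise `u = Q ^ e / r` with `e`
  -- minimal.
  by_cases h : ∃ e : ℕ, 0 < e ∧ ∃ r, IsResiduallyAlgebraic v w r ∧ w (Q ^ e) = w r
  swap
  · obtain ⟨u, hu1, hu⟩ := hw
    refine ⟨u, hu1, hu, fun k a ha h1 => ?_⟩
    have hk : k = 0 := by
      by_contra hk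
      have ha0 : w a ≠ 0 := (Valuation.ne_zero_iff _).2 ha.ne_zero
      rw [map_mul, map_zpow₀] at h1
      have h2 := eq_inv_of_mul_eq_one_left h1
      rcases lt_or_gt_of_ne hk with hk | hk
      · obtain ⟨e, he⟩ := Int.eq_negSucc_of_lt_zero hk
        refine h ⟨e + 1, e.succ_pos, a, ha, ?_⟩
        rw [he, zpow_negSucc, inv_inj] at h2
        rw [map_pow, h2]
      · obtain ⟨e, rfl⟩ := Int.eq_ofNat_of_zero_le hk.le
        refine h ⟨e, by exact_mod_cast hk, a⁻¹, ha.inv, ?_⟩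
        rw [map_pow, map_inv₀, ← h2, zpow_natCast]
    subst hk
    rw [zpow_zero, one_mul] at h1 ⊢
    exact ⟨0, _, ha.isAlgebraic h1, by simp, by simp, by simp⟩
  · classical
    obtain ⟨he, r, hr, hrw⟩ := Nat.find_spec h
    set e := Nat.find h
    have hr0 : r ≠ 0 := hr.ne_zero
    have hr0' : w r ≠ 0 := (Valuation.ne_zero_iff _).2 hr0
    have hu1 : w (Q ^ e / r) = 1 := by rw [map_div₀, hrw, div_self hr0']
    -- An algebraic residue of `Q ^ e / r` would make `Q` residually algebraic.
    refine ⟨Q ^ e / r, hu1, fun halg => hQ ?_, fun k a ha h1 => ?_⟩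
    · refine IsResiduallyAlgebraic.of_pow he ?_
      rw [← div_mul_cancel₀ (Q ^ e) hr0]
      exact IsResiduallyAlgebraic.mul
        (IsResiduallyAlgebraicUnit.isResiduallyAlgebraic ⟨hu1, halg⟩) hr
    · have he' : (e : ℤ) ≠ 0 := by exact_mod_cast he.ne'
      have key : Q ^ k * a = (Q ^ e / r) ^ (k / e) * (Q ^ (k % e) * (r ^ (k / e) * a)) := by
        have h1 : Q ^ k = (Q ^ e) ^ (k / e) * Q ^ (k % e) := by
          rw [← zpow_natCast, ← zpow_mul, ← zpow_add₀ hQ0, Int.mul_ediv_add_emod]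
        rw [div_zpow, h1]
        field_simp
      have ha' : IsResiduallyAlgebraic v w (r ^ (k / e) * a) := (hr.zpow _).mul ha
      have h2 : w (Q ^ (k % e) * (r ^ (k / e) * a)) = 1 := by
        rw [key, map_mul, map_zpow₀, hu1, one_zpow, one_mul] at h1
        exact h1
      -- A nonzero remainder would be a smaller exponent with the property defining `e`.
      have hmod : k % e = 0 := by
        by_contra hne
        have hpos : 0 < k % e := lt_of_le_of_ne (Int.emod_nonneg _ he') (Ne.symm hne)
        obtain ⟨n, hn⟩ := Int.eq_ofNat_of_zero_le hpos.le
        have hlt : n < e := by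
          have := Int.emod_lt_of_pos k (b := e) (by exact_mod_cast he)
          rw [hn] at this
          exact_mod_cast this
        refine Nat.find_min h hlt ⟨by rw [hn] at hpos; exact_mod_cast hpos, _, ha'.inv, ?_⟩
        rw [hn, zpow_natCast, map_mul] at h2
        rw [map_inv₀]
        exact eq_inv_of_mul_eq_one_left h2
      rw [hmod, zpow_zero, one_mul] at h2 key
      refine ⟨k / e, _, ha'.isAlgebraic h2, ?_, by rintro rfl; simp, fun hk => ?_⟩
      · rw [key, valuationResidue_mul (by rw [map_zpow₀, hu1, one_zpow]) h2.le,
          valuationResidue_zpow hu1, mul_comm]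
      · exact Int.ediv_pos_of_pos_of_dvd hk (by positivity) (Int.dvd_of_emod_eq_zero hmod)

/-- A nonzero sum of homogeneous terms of distinct degrees has no cancellation, and its residue
relative to a dominant term is a rational function of `ū` with algebraic coefficients. -/
theorem exists_dominant_of_isGradedPiece {Q : F} (hQ0 : Q ≠ 0) {u : F}
    (hu : Transcendental (ValuationResidueField v) (valuationResidue w u))
    (hQu : ∀ (k : ℤ) (a : F), IsResiduallyAlgebraic v w a → w (Q ^ k * a) = 1 →
        ∃ (m : ℤ) (c : ValuationResidueField w), IsAlgebraic (ValuationResidueField v) c ∧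
          valuationResidue w (Q ^ k * a) = c * valuationResidue w u ^ m ∧
          (k = 0 → m = 0) ∧ (0 < k → 0 < m))
    {s : Finset ℕ} {t : ℕ → F} (ht : ∀ i : ℕ, IsGradedPiece v w Q i (t i)) (hs : ∃ i ∈ s, t i ≠ 0) :
    ∃ j ∈ s, t j ≠ 0 ∧ (∀ i ∈ s, w (t i) ≤ w (t j)) ∧ w (∑ i ∈ s, t i) = w (t j) ∧
      valuationResidue w ((∑ i ∈ s, t i) / t j) ∈
        adjoin (algebraicClosure (ValuationResidueField v) (ValuationResidueField w))
          {valuationResidue w u} := by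
  classical
  obtain ⟨i₁, hi₁, hti₁⟩ := hs
  obtain ⟨i₂, hi₂, hmax⟩ := s.exists_max_image (fun i => w (t i)) ⟨i₁, hi₁⟩
  -- Taking the least index among the terms of largest value leaves only nonnegative powers of the
  -- residue of `u`, with constant term `1`.
  obtain ⟨j, hj, hmin⟩ := (s.filter fun i => w (t i) = w (t i₂)).exists_min_image id
    ⟨i₂, by simp [hi₂]⟩
  rw [Finset.mem_filter] at hj
  obtain ⟨hjs, hj⟩ := hj
  have hle : ∀ i ∈ s, w (t i) ≤ w (t j) := fun i hi => hj ▸ hmax i hi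
  have hj0' : w (t j) ≠ 0 := fun h => hti₁ ((Valuation.zero_iff w).1 (le_zero_iff.1 (h ▸ hle i₁ hi₁)))
  have hj0 : t j ≠ 0 := (Valuation.ne_zero_iff _).1 hj0'
  obtain ⟨b, hb, hjb⟩ := (ht j).resolve_left hj0
  have hle' : ∀ i ∈ s, w (t i / t j) ≤ 1 := fun i hi => by
    rw [map_div₀]; exact div_le_one_of_le₀ (hle i hi) zero_le
  have hterm : ∀ i ∈ s, ∃ (m : ℕ) (c : algebraicClosure (ValuationResidueField v)
      (ValuationResidueField w)), valuationResidue w (t i / t j) = c * valuationResidue w u ^ m ∧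
        (i ≠ j → m ≠ 0) ∧ (i = j → m = 0 ∧ c = 1) := by
    intro i hi
    rcases (hle' i hi).lt_or_eq with hlt | heq
    -- A smaller term has residue zero; the exponent `1` keeps it away from the constant
    -- coefficient.
    · refine ⟨1, 0, ?_, by simp, ?_⟩
      · simpa using (valuationResidue_eq_zero_iff (hle' i hi)).2 hlt
      · rintro rfl
        rw [div_self hj0, map_one] at hlt
        exact absurd hlt (lt_irrefl _)
    · by_cases hij : i = j
      · subst hij
        exact ⟨0, 1, by simp [div_self hj0], by simp, by simp⟩
      · have hi0 : t i ≠ 0 := by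
          intro h; rw [h] at heq; simp at heq
        obtain ⟨a, ha, hia⟩ := (ht i).resolve_left hi0
        have hform : t i / t j = Q ^ ((i : ℤ) - j) * (a / b) := by
          rw [hia, hjb, zpow_sub₀ hQ0]
          exact mul_div_mul_comm _ _ _ _
        have hwi : w (t i) = w (t j) := by
          rwa [map_div₀, div_eq_one_iff_eq hj0'] at heq
        have hji : j ≤ i := hmin i (by rw [Finset.mem_filter]; exact ⟨hi, hwi.trans hj⟩)
        rw [hform] at heq
        obtain ⟨m, c, hc, hres, -, hm⟩ := hQu _ _ (ha.div hb) heq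
        have hm' := hm (by omega)
        obtain ⟨n, rfl⟩ := Int.eq_ofNat_of_zero_le hm'.le
        refine ⟨n, ⟨c, mem_algebraicClosure_iff.2 hc⟩, ?_, fun _ => by omega, fun h => absurd h hij⟩
        rw [hform, hres, zpow_natCast]
  choose! m c hmc hm hmj using hterm
  have hsum : valuationResidue w ((∑ i ∈ s, t i) / t j) =
      aeval (valuationResidue w u) (∑ i ∈ s, C (c i) * X ^ m i) := by
    rw [Finset.sum_div, valuationResidue_sum s hle', map_sum]
    refine Finset.sum_congr rfl fun i hi => ?_
    rw [hmc i hi, map_mul, map_pow, aeval_X, aeval_C]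
    rfl
  have hne : (∑ i ∈ s, C (c i) * X ^ m i) ≠ 0 := by
    intro h
    have h0 := congrArg (fun p => coeff p 0) h
    simp only [finsetSum_coeff, coeff_C_mul, coeff_X_pow, coeff_zero] at h0
    rw [Finset.sum_eq_single_of_mem j hjs fun i hi hij => by simp [(hm i hi hij).symm]] at h0
    simp [hmj j hjs rfl] at h0
  refine ⟨j, hjs, hj0, hle, ?_, ?_⟩
  · have h1 : w ((∑ i ∈ s, t i) / t j) ≤ 1 := by
      rw [Finset.sum_div]; exact w.map_sum_le hle'
    have h2 : ¬ w ((∑ i ∈ s, t i) / t j) < 1 := by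
      rw [← valuationResidue_eq_zero_iff h1, hsum]
      intro h
      exact hu.algebraicClosure ⟨_, hne, h⟩
    have h3 := le_antisymm h1 (not_lt.1 h2)
    rwa [map_div₀, div_eq_one_iff_eq hj0'] at h3
  · rw [hsum]
    exact algebra_adjoin_le_adjoin _ _ (aeval_mem_adjoin_singleton _ _)

theorem exists_dominant_term_of_isGradedPiece {Q : F}
    (hw : ∃ z, w z = 1 ∧ Transcendental (ValuationResidueField v) (valuationResidue w z))
    (hQ0 : Q ≠ 0) (hQ : ¬ IsResiduallyAlgebraic v w Q)
    {s : Finset ℕ} {t : ℕ → F} (ht : ∀ i : ℕ, IsGradedPiece v w Q i (t i)) (hs : ∃ i ∈ s, t i ≠ 0) :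
    ∃ j ∈ s, t j ≠ 0 ∧ (∀ i ∈ s, w (t i) ≤ w (t j)) ∧ w (∑ i ∈ s, t i) = w (t j) := by
  obtain ⟨u, -, hu, hQu⟩ := exists_transcendental_valuationResidue hw hQ0 hQ
  obtain ⟨j, hj, hj0, hle, heq, -⟩ := exists_dominant_of_isGradedPiece hQ0 hu hQu ht hs
  exact ⟨j, hj, hj0, hle, heq⟩

/-- If, up to elements of smaller value, every unit is a quotient of graded sums, then the residue
field extension is ruled. -/
theorem isRuledExtension_of_isGradedSum
    (hfin : ∀ u : F, Transcendental E u → FiniteDimensional E⟮u⟯ F)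
    (hw : ∃ z, w z = 1 ∧ Transcendental (ValuationResidueField v) (valuationResidue w z))
    {Q : F} (hQ0 : Q ≠ 0) (hQ : ¬ IsResiduallyAlgebraic v w Q)
    (hrep : ∀ z, w z = 1 → ∃ g h, IsGradedSum v w Q g ∧ IsGradedSum v w Q h ∧ w (z - g / h) < 1) :
    IsRuledExtension (ValuationResidueField v) (ValuationResidueField w) := by
  obtain ⟨u, hu1, hu, hQu⟩ := exists_transcendental_valuationResidue hw hQ0 hQ
  have := hfin u (transcendental_of_valuationResidue hu1.le hu)
  have := finiteDimensional_algebraicClosure_residueField hu1.le hu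
  refine isRuledExtension_of_forall_mem_adjoin hu fun r => ?_
  obtain ⟨z, hz1, rfl⟩ := exists_valuationResidue_eq r
  rcases hz1.lt_or_eq with hlt | heq
  · rw [(valuationResidue_eq_zero_iff hz1).2 hlt]
    exact zero_mem _
  obtain ⟨g, h, ⟨N, t, ht, rfl⟩, ⟨M, s, hs, rfl⟩, hlt⟩ := hrep z heq
  set g := ∑ i ∈ Finset.range N, t i with hg
  set h := ∑ i ∈ Finset.range M, s i with hh
  have hgh1 : w (g / h) = 1 := by
    have := Valuation.map_sub_eq_of_lt_left w (x := z) (y := z - g / h) (by rwa [heq])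
    rwa [sub_sub_cancel, heq] at this
  rw [valuationResidue_eq_of_sub_lt hgh1.le hlt]
  have hg0 : g ≠ 0 := by intro h; simp [h] at hgh1
  have hh0 : h ≠ 0 := by intro h; simp [h] at hgh1
  obtain ⟨j, -, hj0, -, hj, hjmem⟩ := exists_dominant_of_isGradedPiece hQ0 hu hQu ht
    (Finset.exists_ne_zero_of_sum_ne_zero hg0)
  obtain ⟨l, -, hl0, -, hl, hlmem⟩ := exists_dominant_of_isGradedPiece hQ0 hu hQu hs
    (Finset.exists_ne_zero_of_sum_ne_zero hh0)
  rw [← hg] at hj hjmem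
  rw [← hh] at hl hlmem
  obtain ⟨a, ha, hja⟩ := (ht j).resolve_left hj0
  obtain ⟨b, hb, hlb⟩ := (hs l).resolve_left hl0
  have hform : t j / s l = Q ^ ((j : ℤ) - l) * (a / b) := by
    rw [hja, hlb, zpow_sub₀ hQ0]
    exact mul_div_mul_comm _ _ _ _
  have hw0 : ∀ {z : F}, z ≠ 0 → w z ≠ 0 := (Valuation.ne_zero_iff _).2
  have h1 : w (g / t j) = 1 := by rw [map_div₀, hj, div_self (hw0 hj0)]
  have h2 : w (h / s l) = 1 := by rw [map_div₀, hl, div_self (hw0 hl0)]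
  have h3 : w (t j / s l) = 1 := by rw [map_div₀, ← hj, ← hl, ← map_div₀, hgh1]
  have hmul : g / h = g / t j * (t j / s l) * (h / s l)⁻¹ := by field_simp
  rw [hmul, valuationResidue_mul (by rw [map_mul, h1, h3, one_mul]) (by rw [map_inv₀, h2, inv_one]),
    valuationResidue_mul h1.le h3.le, valuationResidue_inv h2]
  refine mul_mem (mul_mem hjmem ?_) (inv_mem hlmem)
  rw [hform] at h3 ⊢
  obtain ⟨m, c, hc, hres, -⟩ := hQu _ _ (ha.div hb) h3
  rw [hres]
  exact mul_mem (mem_adjoin_algebraicClosure hc) (zpow_mem (mem_adjoin_simple_self _ _) _)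

end Graded

/-! ### Polynomial expansions and quadratic extensions of `E(x)`. -/

section Quadratic

open IntermediateField

/-- Each division by `q` lowers the degree, so the iterated quotients reach zero. One coefficient
sequence serves all large `N`, so that two expansions can be cut at a common length. -/
theorem Polynomial.exists_adic_expansion {E : Type*} [Field E] {q : E[X]} (hq : q.natDegree ≠ 0)
    (g : E[X]) : ∃ c : ℕ → E[X], (∀ i, (c i).degree < q.degree) ∧
      ∀ N, g.natDegree < N → g = ∑ i ∈ Finset.range N, c i * q ^ i := by
  have hq0 : q ≠ 0 := by rintro rfl; simp at hq
  let s : ℕ → E[X] := fun i => (fun p => p / q)^[i] g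
  have hs : ∀ i, s (i + 1) = s i / q := fun i => Function.iterate_succ_apply' _ _ _
  refine ⟨fun i => s i % q, fun i => EuclideanDomain.mod_lt _ hq0, fun N hN => ?_⟩
  have hsum : ∀ N, g = ∑ i ∈ Finset.range N, s i % q * q ^ i + s N * q ^ N := by
    intro N
    induction N with
    | zero => simp [s]
    | succ N ih =>
      rw [Finset.sum_range_succ, hs]
      conv_lhs => rw [ih, ← EuclideanDomain.mod_add_div (s N) q]
      ring
  have hdeg : ∀ i, s i = 0 ∨ (s i).natDegree + i ≤ g.natDegree := by
    intro i
    induction i with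
    | zero => simp [s]
    | succ i ih =>
      rw [hs]
      rcases ih with h | h
      · simp [h]
      by_cases h0 : s i / q = 0
      · exact .inl h0
      right
      have hle : q.degree ≤ (s i).degree := by
        by_contra hlt
        exact h0 ((Polynomial.div_eq_zero_iff hq0).2 (not_le.1 hlt))
      have h1 := degree_add_div hq0 hle
      have hsi : s i ≠ 0 := by intro h; simp [h] at h0
      rw [degree_eq_natDegree hq0, degree_eq_natDegree h0, degree_eq_natDegree hsi] at h1
      have h2 : q.natDegree + (s i / q).natDegree = (s i).natDegree := by exact_mod_cast h1
      omega
  have h0 : s N = 0 := (hdeg N).resolve_right (by omega)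
  conv_lhs => rw [hsum N, h0, zero_mul, add_zero]

variable {E F Γ Γ' : Type*} [Field E] [Field F] [Algebra E F]
  [LinearOrderedCommGroupWithZero Γ] [LinearOrderedCommGroupWithZero Γ']
  {v : Valuation E Γ} {w : Valuation F Γ'} [v.HasExtension w]

/-- There is no cancellation between `E(x)` and `E(x) y`. -/
def IsValuationOrthogonal (E : Type*) {F Γ' : Type*} [Field E] [Field F] [Algebra E F]
    [LinearOrderedCommGroupWithZero Γ'] (w : Valuation F Γ') (x y : F) : Prop :=
  ∀ g ∈ E⟮x⟯, ∀ h ∈ E⟮x⟯, w (g + h * y) = max (w g) (w (h * y))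

/-- If `E(x)` and `E(x) y` are not orthogonal, then every unit has the residue of an element of
`E(x)`. -/
theorem exists_mem_adjoin_sub_lt_one {x y : F} (h2 : w 2 = 1) (hy : y ^ 2 ∈ E⟮x⟯)
    (hrep : ∀ z : F, ∃ g ∈ E⟮x⟯, ∃ h ∈ E⟮x⟯, z = g + h * y)
    (hno : ¬ IsValuationOrthogonal E w x y) {z : F} (hz : w z = 1) :
    ∃ z' ∈ E⟮x⟯, w (z - z') < 1 := by
  simp only [IsValuationOrthogonal, not_forall] at hno
  obtain ⟨g, hg, h, hh, hne⟩ := hno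
  have heq : w g = w (h * y) := by
    by_contra hne'
    exact hne (Valuation.map_add_of_distinct_val w hne')
  have hlt : w (g + h * y) < w (h * y) := by
    refine lt_of_le_of_ne ?_ fun h' => hne (by rw [h', heq, max_self])
    simpa [heq] using w.map_add g (h * y)
  have hhy : w (h * y) ≠ 0 := ne_of_gt (zero_le.trans_lt hlt)
  have hhy0 : h * y ≠ 0 := (Valuation.ne_zero_iff _).1 hhy
  have hh0 : h ≠ 0 := left_ne_zero_of_mul hhy0
  have hg0 : g ≠ 0 := by rw [← Valuation.ne_zero_iff w, heq]; exact hhy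
  -- Cancellation in `g + h * y` says that `y` is close to `k`, that is, `η = y / k` is close to
  -- `1`.
  set k := -g / h with hk
  have hkmem : k ∈ E⟮x⟯ := div_mem (neg_mem hg) hh
  have hk0 : k ≠ 0 := div_ne_zero (neg_ne_zero.2 hg0) hh0
  set η := y / k with hη
  have hη1 : w (η - 1) < 1 := by
    have : η - 1 = -((g + h * y) / g) := by
      rw [hη, hk]; field_simp; ring
    rw [this, Valuation.map_neg, map_div₀, div_lt_one₀ (zero_lt_iff.2 (heq ▸ hhy)), heq]
    exact hlt
  have hηsq : η ^ 2 ∈ E⟮x⟯ := by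
    rw [hη, div_pow]; exact div_mem hy (pow_mem hkmem 2)
  obtain ⟨g', hg', h', hh', rfl⟩ := hrep z
  have hyη : h' * y = h' * k * η := by rw [hη]; field_simp
  rw [hyη] at hz ⊢
  set b := h' * k with hb
  have hbmem : b ∈ E⟮x⟯ := mul_mem hh' hkmem
  rcases le_or_gt (w b) 1 with hb1 | hb1
  · refine ⟨g' + b, add_mem hg' hbmem, ?_⟩
    have : g' + b * η - (g' + b) = b * (η - 1) := by ring
    rw [this, map_mul]
    exact mul_lt_one_of_nonneg_of_lt_one_right hb1 zero_le hη1
  -- Here `z = g' + b * η` is its norm `g' ^ 2 - b ^ 2 * η ^ 2` divided by the conjugate `g' - b * η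
  -- = z - 2 * b * η`. For large `b` this conjugate is close to `-(2 * b)`, since `2` is a unit.
  · have h20 : (2 : F) ≠ 0 := by rw [← Valuation.ne_zero_iff w, h2]; exact one_ne_zero
    have hb0 : b ≠ 0 := by rw [← Valuation.ne_zero_iff w]; exact ne_of_gt (zero_le.trans_lt hb1)
    have h2mem : (2 : F) ∈ E⟮x⟯ := by
      have := IntermediateField.algebraMap_mem E⟮x⟯ (2 : E)
      rwa [map_ofNat] at this
    refine ⟨(g' ^ 2 - b ^ 2 * η ^ 2) / -(2 * b), div_mem (sub_mem (pow_mem hg' 2)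
      (mul_mem (pow_mem hbmem 2) hηsq)) (neg_mem (mul_mem h2mem hbmem)), ?_⟩
    have : g' + b * η - (g' ^ 2 - b ^ 2 * η ^ 2) / -(2 * b) =
        (g' + b * η) * ((g' + b * η) / (2 * b) - (η - 1)) := by field_simp; ring
    rw [this, map_mul, hz, one_mul]
    refine (w.map_sub_lt ?_ hη1)
    rw [map_div₀, map_mul, hz, h2, one_mul, one_div]
    exact inv_lt_one_of_one_lt₀ hb1

variable (v w) in
-- Minimality of the degree makes all digits of `q`-adic expansions residually algebraic or zero at
-- `x`, so these expansions are graded sums in `q(x)`.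
theorem exists_minimal_not_isResiduallyAlgebraic {x : F}
    (h : ∃ p : E[X], p ≠ 0 ∧ ¬ IsResiduallyAlgebraic v w (aeval x p)) :
    ∃ q : E[X], q.natDegree ≠ 0 ∧ ¬ IsResiduallyAlgebraic v w (aeval x q) ∧
      ∀ p : E[X], p.degree < q.degree →
        aeval x p = 0 ∨ IsResiduallyAlgebraic v w (aeval x p) := by
  classical
  have h' : ∃ n, ∃ p : E[X], p ≠ 0 ∧ ¬ IsResiduallyAlgebraic v w (aeval x p) ∧ p.natDegree = n := by
    obtain ⟨p, hp, hp'⟩ := h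
    exact ⟨_, p, hp, hp', rfl⟩
  obtain ⟨q, hq0, hq, hqn⟩ := Nat.find_spec h'
  refine ⟨q, fun hdeg => hq ?_, hq, fun p hp => ?_⟩
  · rw [eq_C_of_natDegree_eq_zero hdeg, aeval_C]
    refine IsResiduallyAlgebraic.of_algebraMap fun h0 => hq0 ?_
    rw [eq_C_of_natDegree_eq_zero hdeg, h0, C_0]
  · by_cases hp0 : p = 0
    · simp [hp0]
    right
    by_contra hcon
    have := Nat.find_min h' (m := p.natDegree) (by
      rw [← hqn]; exact natDegree_lt_natDegree hp0 hp)
    exact this ⟨p, hp0, hcon, rfl⟩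

theorem isGradedSum_aeval {x : F} {q : E[X]} (hq : q.natDegree ≠ 0)
    (hmin : ∀ p : E[X], p.degree < q.degree →
        aeval x p = 0 ∨ IsResiduallyAlgebraic v w (aeval x p)) (g : E[X]) :
    IsGradedSum v w (aeval x q) (aeval x g) := by
  obtain ⟨c, hc, hsum⟩ := exists_adic_expansion hq g
  refine ⟨g.natDegree + 1, fun i => aeval x (c i * q ^ i), fun i => ?_, ?_⟩
  · rcases hmin _ (hc i) with h | h
    · left; simp [h]
    · exact .inr ⟨_, h, by simp [mul_comm]⟩
  · conv_lhs => rw [hsum _ (Nat.lt_succ_self _), map_sum]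

theorem exists_eq_aeval_add_mul_div {x y z : F}
    (hz : ∃ g ∈ E⟮x⟯, ∃ h ∈ E⟮x⟯, z = g + h * y) :
    ∃ p₁ p₂ q : E[X], z = (aeval x p₁ + aeval x p₂ * y) / aeval x q := by
  obtain ⟨g, hg, h, hh, rfl⟩ := hz
  obtain ⟨p₁, q₁, rfl⟩ := (mem_adjoin_simple_iff E g).1 hg
  obtain ⟨p₂, q₂, rfl⟩ := (mem_adjoin_simple_iff E h).1 hh
  -- A fraction with zero denominator is zero, so only the other one remains.
  by_cases h1 : aeval x q₁ = 0
  · exact ⟨0, p₂, q₂, by simp [h1]; ring⟩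
  by_cases h2 : aeval x q₂ = 0
  · exact ⟨p₁, 0, q₁, by simp [h2]⟩
  refine ⟨p₁ * q₂, p₂ * q₁, q₁ * q₂, ?_⟩
  simp only [map_mul]
  field_simp

/-! ### Three cases in which the residue extension is ruled. -/

section Ruled

variable {x y : F} (hx : Transcendental E x)
  (hfin : ∀ u : F, Transcendental E u → FiniteDimensional E⟮u⟯ F)
  (hw : ∃ z, w z = 1 ∧ Transcendental (ValuationResidueField v) (valuationResidue w z))
  (hrep : ∀ z : F, ∃ g ∈ E⟮x⟯, ∃ h ∈ E⟮x⟯, z = g + h * y)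

theorem eq_zero_or_isResiduallyAlgebraic_of_mem_adjoin
    (hall : ∀ p : E[X], p ≠ 0 → IsResiduallyAlgebraic v w (aeval x p)) {z : F} (hz : z ∈ E⟮x⟯) :
    z = 0 ∨ IsResiduallyAlgebraic v w z := by
  obtain ⟨p, q, rfl⟩ := (mem_adjoin_simple_iff E z).1 hz
  by_cases hp : p = 0
  · simp [hp]
  by_cases hq : q = 0
  · simp [hq]
  exact .inr ((hall p hp).div (hall q hq))

include hx hfin hw hrep in
theorem isRuledExtension_of_not_isValuationOrthogonal (h2 : w 2 = 1) (hy : y ^ 2 ∈ E⟮x⟯)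
    (hno : ¬ IsValuationOrthogonal E w x y) :
    IsRuledExtension (ValuationResidueField v) (ValuationResidueField w) := by
  -- If all polynomials in `x` were residually algebraic, the transcendental residue of a unit would
  -- come from `E(x)` and be algebraic.
  obtain ⟨q, hq, hqalg, hmin⟩ := exists_minimal_not_isResiduallyAlgebraic v w (x := x) <| by
    by_contra! hall
    obtain ⟨z, hz1, hz⟩ := hw
    obtain ⟨z', hz', hlt⟩ := exists_mem_adjoin_sub_lt_one h2 hy hrep hno hz1
    have hz'1 : w z' ≤ 1 := by
      have := w.map_sub_le hz1.le hlt.le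
      rwa [sub_sub_cancel] at this
    rw [valuationResidue_eq_of_sub_lt hz'1 hlt] at hz
    exact hz (isAlgebraic_valuationResidue
      (eq_zero_or_isResiduallyAlgebraic_of_mem_adjoin hall hz') hz'1)
  have hq0 : aeval x q ≠ 0 := fun h => hq (by simp [transcendental_iff.1 hx q h])
  refine isRuledExtension_of_isGradedSum hfin hw hq0 hqalg fun z hz => ?_
  obtain ⟨z', hz', hlt⟩ := exists_mem_adjoin_sub_lt_one h2 hy hrep hno hz
  obtain ⟨g, h, rfl⟩ := (mem_adjoin_simple_iff E z').1 hz'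
  exact ⟨_, _, isGradedSum_aeval hq hmin g, isGradedSum_aeval hq hmin h, hlt⟩

include hx hfin hw hrep in
-- Orthogonality excludes cancellation in `c(x) + d(x) y`, so these digits are residually algebraic
-- when `c` and `d` have degree below `q`, and the `q`-adic expansions of both coordinates merge
-- into one graded sum.
theorem isRuledExtension_of_isValuationOrthogonal (hyalg : IsResiduallyAlgebraic v w y)
    (ho : IsValuationOrthogonal E w x y) :
    IsRuledExtension (ValuationResidueField v) (ValuationResidueField w) := by
  have hmem : ∀ p : E[X], aeval x p ∈ E⟮x⟯ := fun p =>
    algebra_adjoin_le_adjoin _ _ (aeval_mem_adjoin_singleton _ _)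
  have hadd : ∀ {g h : F}, g ∈ E⟮x⟯ → h ∈ E⟮x⟯ → (g = 0 ∨ IsResiduallyAlgebraic v w g) →
      (h = 0 ∨ IsResiduallyAlgebraic v w h) →
      g + h * y = 0 ∨ IsResiduallyAlgebraic v w (g + h * y) := by
    intro g h hg hh hg' hh'
    refine IsResiduallyAlgebraic.add hg' ?_ (ho g hg h hh)
    exact hh'.imp (fun h0 => by simp [h0]) fun h0 => h0.mul hyalg
  obtain ⟨q, hq, hqalg, hmin⟩ := exists_minimal_not_isResiduallyAlgebraic v w (x := x) <| by
    by_contra! hall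
    obtain ⟨z, hz1, hz⟩ := hw
    obtain ⟨g, hg, h, hh, rfl⟩ := hrep z
    exact hz (isAlgebraic_valuationResidue (hadd hg hh
      (eq_zero_or_isResiduallyAlgebraic_of_mem_adjoin hall hg)
      (eq_zero_or_isResiduallyAlgebraic_of_mem_adjoin hall hh)) hz1.le)
  have hq0 : aeval x q ≠ 0 := fun h => hq (by simp [transcendental_iff.1 hx q h])
  refine isRuledExtension_of_isGradedSum hfin hw hq0 hqalg fun z hz => ?_
  obtain ⟨p₁, p₂, p₃, hzeq⟩ := exists_eq_aeval_add_mul_div (hrep z)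
  refine ⟨_, _, ?_, isGradedSum_aeval hq hmin p₃, by rw [← hzeq, sub_self, map_zero]; simp⟩
  obtain ⟨c, hc, hcsum⟩ := exists_adic_expansion hq p₁
  obtain ⟨d, hd, hdsum⟩ := exists_adic_expansion hq p₂
  refine ⟨p₁.natDegree + p₂.natDegree + 1,
    fun i => aeval x q ^ i * (aeval x (c i) + aeval x (d i) * y), fun i => ?_, ?_⟩
  · rcases hadd (hmem _) (hmem _) (hmin _ (hc i)) (hmin _ (hd i)) with h | h
    · left; simp [h]
    · exact .inr ⟨_, h, by simp⟩
  · have h₁ := congrArg (aeval x) (hcsum (p₁.natDegree + p₂.natDegree + 1) (by omega))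
    have h₂ := congrArg (aeval x) (hdsum (p₁.natDegree + p₂.natDegree + 1) (by omega))
    rw [h₁, h₂, map_sum, map_sum, Finset.sum_mul, ← Finset.sum_add_distrib]
    refine Finset.sum_congr rfl fun i _ => ?_
    simp only [map_mul, map_pow]
    ring

include hx hfin hw hrep in
theorem isRuledExtension_of_isResiduallyAlgebraic (h2 : w 2 = 1) (hy : y ^ 2 ∈ E⟮x⟯)
    (hyalg : IsResiduallyAlgebraic v w y) :
    IsRuledExtension (ValuationResidueField v) (ValuationResidueField w) := by
  by_cases ho : IsValuationOrthogonal E w x y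
  · exact isRuledExtension_of_isValuationOrthogonal hx hfin hw hrep hyalg ho
  · exact isRuledExtension_of_not_isValuationOrthogonal hx hfin hw hrep h2 hy ho

include hfin hw hrep in
-- Since `x = y ^ 2 * a⁻¹`, the monomial `x ^ j * y ^ ε` has degree `2 * j + ε` in `y`. The parts in
-- `E[x]` and `E[x] y` occupy the even and the odd degrees, so orthogonality need not be assumed.
theorem isRuledExtension_of_sq_eq_mul (hx0 : x ≠ 0) (hx : ¬ IsResiduallyAlgebraic v w x) {a : F}
    (ha : IsResiduallyAlgebraic v w a) (hy : y ^ 2 = x * a) :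
    IsRuledExtension (ValuationResidueField v) (ValuationResidueField w) := by
  have hxy : x = y ^ 2 * a⁻¹ := by rw [hy, mul_inv_cancel_right₀ ha.ne_zero]
  have hy0 : y ≠ 0 := by
    rintro rfl
    exact hx0 (by rw [hxy]; simp)
  have hyalg : ¬ IsResiduallyAlgebraic v w y := fun h => hx (hxy ▸ (h.pow 2).mul ha.inv)
  have hpiece : ∀ (c : E) (j : ℕ) (ε : ℕ),
      IsGradedPiece v w y ((2 * j + ε : ℕ) : ℤ) (algebraMap E F c * x ^ j * y ^ ε) := by
    intro c j ε
    by_cases hc : c = 0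
    · left; simp [hc]
    · refine .inr ⟨_, (IsResiduallyAlgebraic.of_algebraMap hc).mul (ha.inv.pow j), ?_⟩
      rw [zpow_natCast, pow_add, pow_mul, hxy, mul_pow]
      ring
  have hsum : ∀ p₁ p₂ : E[X], IsGradedSum v w y (aeval x p₁ + aeval x p₂ * y) := by
    intro p₁ p₂
    set N := p₁.natDegree + p₂.natDegree + 1
    let t : ℕ → F := fun i => if i % 2 = 0 then algebraMap E F (p₁.coeff (i / 2)) * x ^ (i / 2)
      else algebraMap E F (p₂.coeff (i / 2)) * x ^ (i / 2) * y
    refine ⟨2 * N, t, fun i => ?_, ?_⟩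
    · rcases Nat.mod_two_eq_zero_or_one i with h | h
      · have := hpiece (p₁.coeff (i / 2)) (i / 2) 0
        rw [show 2 * (i / 2) + 0 = i by omega] at this
        simpa [t, h] using this
      · have := hpiece (p₂.coeff (i / 2)) (i / 2) 1
        rw [show 2 * (i / 2) + 1 = i by omega] at this
        simpa [t, h] using this
    · have hpair : ∀ N, ∑ i ∈ Finset.range (2 * N), t i =
          ∑ i ∈ Finset.range N, (t (2 * i) + t (2 * i + 1)) := by
        intro N
        induction N with
        | zero => simp
        | succ N ih =>
          rw [Nat.mul_succ, Finset.sum_range_succ, Finset.sum_range_succ, ih,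
            Finset.sum_range_succ, add_assoc]
      rw [hpair, Finset.sum_add_distrib, aeval_eq_sum_range' (n := N) (by omega),
        aeval_eq_sum_range' (n := N) (by omega), Finset.sum_mul]
      have h1 : ∀ i, (2 * i + 1) / 2 = i := fun i => by omega
      have h3 : ∀ i, (2 * i + 1) % 2 = 1 := fun i => by omega
      simp [t, Algebra.smul_def, h1, h3]
  refine isRuledExtension_of_isGradedSum hfin hw hy0 hyalg fun z hz => ?_
  obtain ⟨p₁, p₂, q, hzeq⟩ := exists_eq_aeval_add_mul_div (hrep z)
  refine ⟨_, _, hsum p₁ p₂, by simpa using hsum q 0, by rw [← hzeq, sub_self, map_zero]; simp⟩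

end Ruled

end Quadratic

/-! ### Two tying terms of `f(x)` in the non-ruled case. -/

section Counting

open IntermediateField

variable {E F Γ Γ' : Type*} [Field E] [Field F] [Algebra E F]
  [LinearOrderedCommGroupWithZero Γ] [LinearOrderedCommGroupWithZero Γ']

theorem ne_zero_of_transcendental {x : F} (hx : Transcendental E x) : x ≠ 0 :=
  fun h => hx (h ▸ isAlgebraic_zero)

theorem exists_eq_add_mul_of_adjoin_eq_top {x y : F} (hy : y ^ 2 ∈ E⟮x⟯)
    (hF : adjoin E {x, y} = ⊤) (z : F) : ∃ g ∈ E⟮x⟯, ∃ h ∈ E⟮x⟯, z = g + h * y := by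
  have hyint : IsIntegral E⟮x⟯ y :=
    ⟨X ^ 2 - C ⟨y ^ 2, hy⟩, monic_X_pow_sub_C _ two_ne_zero, by
      rw [← aeval_def]; simp [IntermediateField.algebraMap_apply]⟩
  have hz : z ∈ E⟮x⟯⟮y⟯ := by
    have h1 : z ∈ adjoin E {x, y} := hF ▸ mem_top
    rwa [← Set.singleton_union, ← adjoin_adjoin_left, mem_restrictScalars] at h1
  rw [← mem_toSubalgebra, adjoin_simple_toSubalgebra_of_isAlgebraic hyint.isAlgebraic,
    Algebra.adjoin_singleton_eq_range_aeval] at hz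
  obtain ⟨p, rfl⟩ := hz
  change ∃ g ∈ E⟮x⟯, ∃ h ∈ E⟮x⟯, aeval y p = g + h * y
  induction p using Polynomial.induction_on' with
  | add p q hp hq =>
    obtain ⟨g, hg, h, hh, hgh⟩ := hp
    obtain ⟨g', hg', h', hh', hgh'⟩ := hq
    exact ⟨_, add_mem hg hg', _, add_mem hh hh', by rw [map_add, hgh, hgh']; ring⟩
  | monomial n a =>
    rw [aeval_monomial]
    rcases Nat.even_or_odd' n with ⟨k, rfl | rfl⟩
    · exact ⟨_, mul_mem a.2 (pow_mem hy k), 0, zero_mem _, by rw [pow_mul, zero_mul, add_zero]; rfl⟩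
    · refine ⟨0, zero_mem _, _, mul_mem a.2 (pow_mem hy k), ?_⟩
      rw [pow_succ, pow_mul, zero_add, mul_assoc]
      rfl

variable {v : Valuation E Γ} {w : Valuation F Γ'}

theorem IsOvert.exists_forall_le {f : E[X]} {x : F} (h : IsOvert w f x) :
    ∃ j ≤ f.natDegree, w (aeval x f) = w (algebraMap E F (f.coeff j) * x ^ j) ∧
      ∀ i ∈ Finset.range (f.natDegree + 1), w (algebraMap E F (f.coeff i) * x ^ i) ≤
        w (algebraMap E F (f.coeff j) * x ^ j) := by
  obtain ⟨j, hj, hmax⟩ := Finset.exists_mem_eq_sup' (Finset.nonempty_range_add_one (n := f.natDegree))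
    fun j => w (algebraMap E F (f.coeff j) * x ^ j)
  rw [Finset.mem_range, Nat.lt_succ_iff] at hj
  refine ⟨j, hj, h.trans hmax, fun i hi => ?_⟩
  rw [← hmax]
  exact Finset.le_sup' (fun j => w (algebraMap E F (f.coeff j) * x ^ j)) hi

variable [v.HasExtension w]

theorem exists_transcendental_unit
    (h : Algebra.Transcendental (ValuationResidueField v) (ValuationResidueField w)) :
    ∃ z, w z = 1 ∧ Transcendental (ValuationResidueField v) (valuationResidue w z) := by
  obtain ⟨r, hr⟩ := Algebra.transcendental_def.1 h
  obtain ⟨z, hz, rfl⟩ := exists_valuationResidue_eq r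
  refine ⟨z, hz.antisymm (not_lt.1 fun hlt => hr ?_), hr⟩
  rw [(valuationResidue_eq_zero_iff hz).2 hlt]
  exact isAlgebraic_zero

/-- For an overt residually transcendental extension with non-ruled residue field extension, `x` is
not residually algebraic, `E(x)` is orthogonal to `E(x) y`, and two distinct terms of `f(x)` have the
same value. -/
theorem exists_terms_of_not_isRuledExtension {f : E[X]} {x y : F}
    (hx : Transcendental E x) (hfin : ∀ u : F, Transcendental E u → FiniteDimensional E⟮u⟯ F)
    (hw : ∃ z, w z = 1 ∧ Transcendental (ValuationResidueField v) (valuationResidue w z))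
    (hrep : ∀ z : F, ∃ g ∈ E⟮x⟯, ∃ h ∈ E⟮x⟯, z = g + h * y) (h2 : w 2 = 1) (hf : f ≠ 0)
    (hy : y ^ 2 = aeval x f) (ho : IsOvert w f x)
    (hnr : ¬ IsRuledExtension (ValuationResidueField v) (ValuationResidueField w)) :
    ¬ IsResiduallyAlgebraic v w x ∧ IsValuationOrthogonal E w x y ∧
      ∃ i j, i < j ∧ j ≤ f.natDegree ∧ f.coeff i ≠ 0 ∧ f.coeff j ≠ 0 ∧
        w (algebraMap E F (f.coeff i) * x ^ i) = w (algebraMap E F (f.coeff j) * x ^ j) := by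
  have hxmem : x ∈ E⟮x⟯ := mem_adjoin_simple_self E x
  have hysq : y ^ 2 ∈ E⟮x⟯ := hy ▸ algebra_adjoin_le_adjoin _ _ (aeval_mem_adjoin_singleton _ _)
  have hx0 : x ≠ 0 := ne_zero_of_transcendental hx
  have hfx0 : aeval x f ≠ 0 := fun h => hf (transcendental_iff.1 hx f h)
  set t : ℕ → F := fun j => algebraMap E F (f.coeff j) * x ^ j with ht
  have hft : aeval x f = ∑ i ∈ Finset.range (f.natDegree + 1), t i := by
    rw [aeval_eq_sum_range]
    exact Finset.sum_congr rfl fun i _ => Algebra.smul_def _ _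
  obtain ⟨j, hj, hjeq, hle⟩ := ho.exists_forall_le
  have hjr : j ∈ Finset.range (f.natDegree + 1) := Finset.mem_range_succ_iff.2 hj
  have htj0' : w (t j) ≠ 0 := by
    rw [← hjeq]; exact (Valuation.ne_zero_iff w).2 hfx0
  have htj0 : t j ≠ 0 := (Valuation.ne_zero_iff w).1 htj0'
  have hc0 : ∀ {i}, t i ≠ 0 → f.coeff i ≠ 0 := fun h h' => h (by simp [ht, h'])
  have hxalg : ¬ IsResiduallyAlgebraic v w x := by
    intro hxa
    refine hnr (isRuledExtension_of_isResiduallyAlgebraic hx hfin hw hrep h2 hysq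
      (IsResiduallyAlgebraic.of_pow two_pos ?_))
    rw [hy, hft]
    refine IsResiduallyAlgebraic.sum (fun i _ => ?_) hjr hle (hft ▸ hjeq) htj0
    by_cases hi : f.coeff i = 0
    · left; simp [ht, hi]
    · exact .inr ((IsResiduallyAlgebraic.of_algebraMap hi).mul (hxa.pow i))
  refine ⟨hxalg, by_contra fun hno => hnr
    (isRuledExtension_of_not_isValuationOrthogonal hx hfin hw hrep h2 hysq hno), ?_⟩
  by_contra! hcon
  -- Without a tie the dominant term is strictly dominant, so `f(x) / t j` has residue `1`.
  have hlt : ∀ i ∈ Finset.range (f.natDegree + 1), i ≠ j → w (t i) < w (t j) := by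
    intro i hi hij
    refine lt_of_le_of_ne (hle i hi) fun heq => ?_
    have hti0 : t i ≠ 0 := by rw [← Valuation.ne_zero_iff w, heq]; exact htj0'
    rcases lt_or_gt_of_ne hij with h | h
    · exact hcon i j h hj (hc0 hti0) (hc0 htj0) heq
    · exact hcon j i h (Finset.mem_range_succ_iff.1 hi) (hc0 htj0) (hc0 hti0) heq.symm
  have hsub : w (aeval x f / t j - 1) < 1 := by
    rw [← div_self htj0, ← sub_div, map_div₀, div_lt_one₀ (zero_lt_iff.2 htj0'), hft,
      ← Finset.add_sum_erase _ _ hjr, add_sub_cancel_left]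
    refine Valuation.map_sum_lt w htj0' fun i hi => ?_
    exact hlt i (Finset.mem_of_mem_erase hi) (Finset.ne_of_mem_erase hi)
  have hunit : IsResiduallyAlgebraicUnit v w (aeval x f / t j) := by
    refine ⟨by rw [map_div₀, hjeq, div_self htj0'], ?_⟩
    rw [valuationResidue_eq_of_sub_lt (by simp) hsub, valuationResidue_one]
    exact isAlgebraic_one
  have ha : IsResiduallyAlgebraic v w (aeval x f / x ^ j) := by
    have := (IsResiduallyAlgebraic.of_algebraMap (v := v) (w := w) (hc0 htj0)).mul
      hunit.isResiduallyAlgebraic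
    convert this using 1
    have := (map_ne_zero (algebraMap E F)).2 (hc0 htj0)
    simp only [ht]
    field_simp
  have hrep' : ∀ k : ℕ, ∀ z : F, ∃ g ∈ E⟮x⟯, ∃ h ∈ E⟮x⟯, z = g + h * (y / x ^ k) := by
    intro k z
    obtain ⟨g, hg, h, hh, rfl⟩ := hrep z
    exact ⟨g, hg, h * x ^ k, mul_mem hh (pow_mem hxmem k), by field_simp⟩
  -- The square of `y / x ^ k` is residually algebraic for `j = 2 * k`, and `x` times such an
  -- element for `j = 2 * k + 1`.
  rcases Nat.even_or_odd' j with ⟨k, hk | hk⟩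
  · refine hnr (isRuledExtension_of_isResiduallyAlgebraic hx hfin hw (hrep' k) h2 ?_
      (IsResiduallyAlgebraic.of_pow two_pos ?_))
    · rw [div_pow]
      exact div_mem hysq (pow_mem (pow_mem hxmem k) 2)
    · rwa [div_pow, hy, ← pow_mul, mul_comm k, ← hk]
  · refine hnr (isRuledExtension_of_sq_eq_mul hfin hw (hrep' k) hx0 hxalg ha ?_)
    rw [div_pow, hy, hk]
    field_simp
    ring

end Counting

/-! ### The valuation is determined by the tying pair. -/

section Uniqueness

open IntermediateField

variable {E F Γ Γ₁ Γ₂ : Type*} [Field E] [Field F] [Algebra E F]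
  [LinearOrderedCommGroupWithZero Γ] [LinearOrderedCommGroupWithZero Γ₁]
  [LinearOrderedCommGroupWithZero Γ₂] {v : Valuation E Γ}

/-- As `x` is not residually algebraic, it can serve as the grading element itself, with scalar
coefficients. -/
theorem exists_dominant_term_aeval {w : Valuation F Γ₁} [v.HasExtension w] {x : F}
    (hw : ∃ z, w z = 1 ∧ Transcendental (ValuationResidueField v) (valuationResidue w z))
    (hx0 : x ≠ 0) (hx : ¬ IsResiduallyAlgebraic v w x) (p : E[X]) :
    ∃ j ∈ Finset.range (p.natDegree + 1), w (aeval x p) = w (algebraMap E F (p.coeff j) * x ^ j) ∧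
      ∀ i ∈ Finset.range (p.natDegree + 1), w (algebraMap E F (p.coeff i) * x ^ i) ≤
        w (algebraMap E F (p.coeff j) * x ^ j) := by
  have hsum : aeval x p = ∑ i ∈ Finset.range (p.natDegree + 1), algebraMap E F (p.coeff i) * x ^ i := by
    rw [aeval_eq_sum_range]
    exact Finset.sum_congr rfl fun i _ => Algebra.smul_def _ _
  by_cases hne : ∃ i ∈ Finset.range (p.natDegree + 1), algebraMap E F (p.coeff i) * x ^ i ≠ 0
  · obtain ⟨j, hj, -, hle, heq⟩ := exists_dominant_term_of_isGradedPiece hw hx0 hx (fun i => by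
      by_cases h : p.coeff i = 0
      · left; simp [h]
      · exact .inr ⟨_, IsResiduallyAlgebraic.of_algebraMap h, by rw [zpow_natCast, mul_comm]⟩) hne
    exact ⟨j, hj, by rw [hsum, heq], hle⟩
  · push Not at hne
    refine ⟨0, by simp, ?_, fun i hi => by rw [hne i hi, map_zero]; exact zero_le⟩
    rw [hsum, Finset.sum_eq_zero hne, hne 0 (by simp)]

/-- Raising to the power `m` replaces `x ^ m` by `b` and moves the comparison to `E`, so it depends
only on `v`, `m` and `b`. -/
theorem map_monomial_le_iff {w : Valuation F Γ₁} [v.HasExtension w] {x : F} {m : ℕ} (hm : m ≠ 0)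
    {b : E} (hb : w x ^ m = w (algebraMap E F b)) (c d : E) (i j : ℕ) :
    w (algebraMap E F c * x ^ i) ≤ w (algebraMap E F d * x ^ j) ↔
      v (c ^ m * b ^ i) ≤ v (d ^ m * b ^ j) := by
  rw [← pow_le_pow_iff_left₀ zero_le zero_le hm, ← Valuation.HasExtension.val_map_le_iff v w]
  have : ∀ (c : E) (i : ℕ), w (algebraMap E F c * x ^ i) ^ m = w (algebraMap E F (c ^ m * b ^ i)) := by
    intro c i
    simp only [map_mul, map_pow, mul_pow]
    rw [← pow_mul, mul_comm i, pow_mul, hb]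
  rw [this, this]

/-- Orthogonality for `w₁` bounds `g` and `h * y` separately. Both `g` and `(h * y) ^ 2` lie in
`E(x)`, where the values of monomials decide all comparisons. -/
theorem map_le_one_of_map_le_one {w₁ : Valuation F Γ₁} {w₂ : Valuation F Γ₂} [v.HasExtension w₁]
    [v.HasExtension w₂] {x y : F} (hx : Transcendental E x) (hy : y ^ 2 ∈ E⟮x⟯)
    (hrep : ∀ z : F, ∃ g ∈ E⟮x⟯, ∃ h ∈ E⟮x⟯, z = g + h * y)
    (hw₁ : ∃ z, w₁ z = 1 ∧ Transcendental (ValuationResidueField v) (valuationResidue w₁ z))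
    (hw₂ : ∃ z, w₂ z = 1 ∧ Transcendental (ValuationResidueField v) (valuationResidue w₂ z))
    (hx₁ : ¬ IsResiduallyAlgebraic v w₁ x) (hx₂ : ¬ IsResiduallyAlgebraic v w₂ x)
    (ho : IsValuationOrthogonal E w₁ x y) {m : ℕ} (hm : m ≠ 0) {b : E}
    (hb₁ : w₁ x ^ m = w₁ (algebraMap E F b)) (hb₂ : w₂ x ^ m = w₂ (algebraMap E F b))
    {z : F} (hz : w₁ z ≤ 1) : w₂ z ≤ 1 := by
  have hpoly : ∀ p q : E[X], w₁ (aeval x p) ≤ w₁ (aeval x q) → w₂ (aeval x p) ≤ w₂ (aeval x q) := by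
    intro p q hpq
    obtain ⟨i, hi, hieq, -⟩ := exists_dominant_term_aeval hw₂ (ne_zero_of_transcendental hx) hx₂ p
    obtain ⟨i', -, hieq', hle'⟩ := exists_dominant_term_aeval hw₁ (ne_zero_of_transcendental hx) hx₁ p
    obtain ⟨j, hj, hjeq, -⟩ := exists_dominant_term_aeval hw₁ (ne_zero_of_transcendental hx) hx₁ q
    obtain ⟨j', -, hjeq', hle⟩ := exists_dominant_term_aeval hw₂ (ne_zero_of_transcendental hx) hx₂ q
    rw [hieq, hjeq']
    refine le_trans ?_ (hle j hj)
    rw [hieq', hjeq] at hpq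
    have := (hle' i hi).trans hpq
    rw [map_monomial_le_iff (v := v) hm hb₁] at this
    rwa [map_monomial_le_iff (v := v) hm hb₂]
  have hadj : ∀ z ∈ E⟮x⟯, w₁ z ≤ 1 → w₂ z ≤ 1 := by
    intro z hz h
    obtain ⟨p, q, rfl⟩ := (mem_adjoin_simple_iff E z).1 hz
    by_cases hq : aeval x q = 0
    · simp [hq]
    rw [map_div₀, div_le_one₀ (zero_lt_iff.2 ((Valuation.ne_zero_iff _).2 hq))] at h
    rw [map_div₀, div_le_one₀ (zero_lt_iff.2 ((Valuation.ne_zero_iff _).2 hq))]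
    exact hpoly p q h
  obtain ⟨g, hg, h, hh, rfl⟩ := hrep z
  rw [ho g hg h hh, max_le_iff] at hz
  refine w₂.map_add_le (hadj g hg hz.1) ?_
  rw [← pow_le_one_iff_of_nonneg zero_le two_ne_zero, ← map_pow]
  refine hadj _ (by rw [mul_pow]; exact mul_mem (pow_mem hh 2) hy) ?_
  rw [map_pow]
  exact pow_le_one' hz.2 2

end Uniqueness

/-! ### The bound on the number of extensions. -/

theorem mainTheorem2 {E F Γ : Type*} [Field E] [Field F] [Algebra E F]
    [LinearOrderedCommGroupWithZero Γ] (v : Valuation E Γ) (hv : v 2 = 1)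
    (n : ℕ) (f : E[X]) (hf : f.degree = n)
    (x y : F) (hx : Transcendental E x) (hy : y ^ 2 = aeval x f)
    (hF : IntermediateField.adjoin E {x, y} = ⊤) :
    (overtNonRuledExtensions v f x).encard ≤ (n : ℕ∞) ^ 2 := by
  classical
  open IntermediateField in
  have hysq : y ^ 2 ∈ E⟮x⟯ := hy ▸ algebra_adjoin_le_adjoin _ _ (aeval_mem_adjoin_singleton _ _)
  have hrep := exists_eq_add_mul_of_adjoin_eq_top hysq hF
  have hyalg : IsAlgebraic E⟮x⟯ y := IsAlgebraic.of_pow two_pos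
    (isAlgebraic_algebraMap (⟨y ^ 2, hysq⟩ : E⟮x⟯))
  have hfin : ∀ u : F, Transcendental E u → FiniteDimensional E⟮u⟯ F := fun u hu =>
    finiteDimensional_adjoin_simple_of_transcendental hyalg hF hu
  have hf0 : f ≠ 0 := by rintro rfl; simp at hf
  have hfn : f.natDegree = n := natDegree_eq_of_degree_eq_some hf
  have hmem : ∀ A : ValuationSubring F, A ∈ overtNonRuledExtensions v f x →
      ∃ _ : v.HasExtension A.valuation, (∃ z, A.valuation z = 1 ∧
        Transcendental (ValuationResidueField v) (valuationResidue A.valuation z)) ∧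
      ¬ IsResiduallyAlgebraic v A.valuation x ∧ IsValuationOrthogonal E A.valuation x y ∧
      ∃ ij : ℕ × ℕ, ij.1 < ij.2 ∧ ij.2 ≤ n ∧ f.coeff ij.1 ≠ 0 ∧ f.coeff ij.2 ≠ 0 ∧
        A.valuation (algebraMap E F (f.coeff ij.1) * x ^ ij.1) =
          A.valuation (algebraMap E F (f.coeff ij.2) * x ^ ij.2) := by
    rintro A ⟨⟨hext, htr⟩, ho, ⟨_, hnr⟩⟩
    have h2 : A.valuation 2 = 1 := by
      have := (Valuation.HasExtension.val_map_eq_one_iff v A.valuation 2).2 hv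
      rwa [map_ofNat] at this
    have hw := exists_transcendental_unit htr
    obtain ⟨hxa, horth, i, j, hij, hj, hi0, hj0, heq⟩ :=
      exists_terms_of_not_isRuledExtension hx hfin hw hrep h2 hf0 hy ho hnr
    exact ⟨hext, hw, hxa, horth, (i, j), hij, hfn ▸ hj, hi0, hj0, heq⟩
  choose! hext hw hxa horth ij hij hj hi0 hj0 heq using hmem
  have hpow : ∀ A (hA : A ∈ overtNonRuledExtensions v f x),
      A.valuation x ^ ((ij A).2 - (ij A).1) =
        A.valuation (algebraMap E F (f.coeff (ij A).1 / f.coeff (ij A).2)) := by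
    intro A hA
    have h0 : ∀ {c : E}, c ≠ 0 → A.valuation (algebraMap E F c) ≠ 0 := fun h =>
      (Valuation.ne_zero_iff _).2 ((map_ne_zero (algebraMap E F)).2 h)
    have hx0 : A.valuation x ≠ 0 := (Valuation.ne_zero_iff _).2 (ne_zero_of_transcendental hx)
    have h := heq A hA
    rw [map_mul, map_mul, map_pow, map_pow] at h
    rw [map_div₀, map_div₀, eq_div_iff (h0 (hj0 A hA)), pow_sub₀ _ hx0 (hij A hA).le]
    field_simp
    rw [mul_comm, ← h, mul_comm]
  -- Since `i < j ≤ n`, both `i` and `j - 1` lie below `n`, and `j` is recovered from `j - 1`.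
  have hinj : Set.InjOn (fun A => ((ij A).1, (ij A).2 - 1)) (overtNonRuledExtensions v f x) := by
    intro A hA B hB hAB
    have hijAB : ij A = ij B := by
      simp only [Prod.mk.injEq] at hAB
      have h1 := hij A hA
      have h2 := hij B hB
      exact Prod.ext hAB.1 (by omega)
    have hA' := hext A hA
    have hB' := hext B hB
    have hm : (ij A).2 - (ij A).1 ≠ 0 := by
      have := hij A hA
      omega
    have hpA := hpow A hA
    have hpB := hpow B hB
    rw [← hijAB] at hpB
    ext z
    rw [← A.valuation_le_one_iff, ← B.valuation_le_one_iff]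
    exact ⟨map_le_one_of_map_le_one hx hysq hrep (hw A hA) (hw B hB) (hxa A hA) (hxa B hB)
      (horth A hA) hm hpA hpB, map_le_one_of_map_le_one hx hysq hrep (hw B hB) (hw A hA)
      (hxa B hB) (hxa A hA) (horth B hB) hm hpB hpA⟩
  have hmaps : Set.MapsTo (fun A => ((ij A).1, (ij A).2 - 1)) (overtNonRuledExtensions v f x)
      (↑(Finset.range n ×ˢ Finset.range n) : Set (ℕ × ℕ)) := by
    intro A hA
    have h1 := hij A hA
    have h2 := hj A hA
    simp only [Finset.coe_product, Finset.coe_range, Set.mem_prod, Set.mem_Iio]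
    omega
  refine (Set.encard_le_encard_of_injOn hmaps hinj).trans ?_
  rw [Set.encard_coe_eq_coe_finsetCard, Finset.card_product, Finset.card_range, ← sq]
  simp
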